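/- Let $K$ be an algebraically closed field of characteristic zero, and let $G$ be a reductive group over $K$, i.e. an affine algebraic group all of whose finite-dimensional rational representations are completely reducible. Let $G$ act on an irreducible affine scheme $X=\operatorname{Spec} A$ of finite type over $K$, put $X/\!\!/G=\operatorname{Spec}(A^G)$, and let $\pi:X\to X/\!\!/G$ be the morphism given by the inclusion $A^G\subseteq A$. For a natural number $i$, a scheme $Y$ is said to have property $(S_i)$ if $$\operatorname{depth}(\mathcal{O}_{Y,Z})\ \ge\ \min(i,\operatorname{codim}_Y Z)$$ for every irreducible closed subset $Z$ of $Y$, where $\mathcal{O}_{Y,Z}$ is the local ring of $Y$ at the generic point of $Z$. The codimension of a closed subset of $Y$ is the infimum of the codimensions of the irreducible closed subsets of $Y$ that it contains; the empty set has codimension $\infty$. **Theorem.** Let $U$ be an open subscheme of $X/\!\!/G$. Suppose that $X$ and $U$ have property $(S_i)$ and that $\pi^{-1}\big((X/\!\!/G)\setminus U\big)$ has codimension at least $i$ in $X$. Then $X/\!\!/G$ has property $(S_i)$. -/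

import Mathlib

open AlgebraicGeometry TopologicalSpace
open scoped TensorProduct

universe u

/-! ## Affine algebraic groups and their rational representations

An affine algebraic group `G` over a field `K` is given by its coordinate ring `H = K[G]`, a
commutative Hopf algebra of finite type over `K`. -/

/-- A rational (left) representation on `V` of the affine algebraic group with coordinate
ring `H`, given as usual by its coaction `V → V ⊗ H`: if `v` is sent to `∑ vᵢ ⊗ hᵢ`
then `g • v = ∑ hᵢ(g) vᵢ`. -/
structure RationalRep (K H V : Type*) [Field K] [CommRing H] [HopfAlgebra K H]
    [AddCommGroup V] [Module K V] where
  /-- The coaction. -/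
  coact : V →ₗ[K] V ⊗[K] H
  /-- `g • (h • v) = (g h) • v`. -/
  coassoc : (TensorProduct.assoc K V H H).toLinearMap ∘ₗ coact.rTensor H ∘ₗ coact =
    (Coalgebra.comul (R := K) (A := H)).lTensor V ∘ₗ coact
  /-- `1 • v = v`. -/
  counit_coact : (TensorProduct.rid K V).toLinearMap ∘ₗ
    (Coalgebra.counit (R := K) (A := H)).lTensor V ∘ₗ coact = LinearMap.id

/-- A subspace `W` is a subrepresentation if the coaction sends `W` into `W ⊗ H`. -/
def RationalRep.IsSubrep {K H V : Type*} [Field K] [CommRing H] [HopfAlgebra K H]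
    [AddCommGroup V] [Module K V] (ρ : RationalRep K H V) (W : Submodule K V) : Prop :=
  ∀ w ∈ W, ρ.coact w ∈ LinearMap.range (W.subtype.rTensor H)

/-- Reductivity of the affine algebraic group with coordinate ring `H` over a field `K` of
characteristic zero: every finite-dimensional rational representation is completely reducible,
that is, every subrepresentation has a complementary subrepresentation. -/
def IsReductiveGroup (K H : Type u) [Field K] [CommRing H] [HopfAlgebra K H] : Prop :=
  ∀ (V : Type u) [AddCommGroup V] [Module K V] [FiniteDimensional K V]
    (ρ : RationalRep K H V) (W : Submodule K V), ρ.IsSubrep W →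
      ∃ W' : Submodule K V, ρ.IsSubrep W' ∧ IsCompl W W'

/-! ## Actions on affine schemes and the quotient `X // G` -/

/-- An action of the affine algebraic group `G` with coordinate ring `H` on the affine
scheme `X = Spec A`, given by the corresponding rational action of `G` on `A` by `K`-algebra
automorphisms, `(g • f)(x) = f(g⁻¹ x)`. Its coaction `A → A ⊗ H` is the homomorphism of
`K`-algebras which is dual to the morphism `X × G → X`, `(x, g) ↦ g⁻¹ x`. -/
structure AffineAction (K H A : Type*) [Field K] [CommRing H] [HopfAlgebra K H]
    [CommRing A] [Algebra K A] where
  /-- The coaction. -/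
  coact : A →ₐ[K] A ⊗[K] H
  /-- `g • (h • f) = (g h) • f`. -/
  coassoc : (TensorProduct.assoc K A H H).toLinearMap ∘ₗ coact.toLinearMap.rTensor H ∘ₗ
      coact.toLinearMap =
    (Coalgebra.comul (R := K) (A := H)).lTensor A ∘ₗ coact.toLinearMap
  /-- `1 • f = f`. -/
  counit_coact : (TensorProduct.rid K A).toLinearMap ∘ₗ
    (Coalgebra.counit (R := K) (A := H)).lTensor A ∘ₗ coact.toLinearMap = LinearMap.id

namespace AffineAction

variable {K H A : Type u} [Field K] [CommRing H] [HopfAlgebra K H] [CommRing A] [Algebra K A]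

/-- The algebra of invariants `A^G`, consisting of the `a` with coaction `a ⊗ 1`. -/
def invariants (σ : AffineAction K H A) : Subalgebra K A :=
  AlgHom.equalizer σ.coact (Algebra.TensorProduct.includeLeft : A →ₐ[K] A ⊗[K] H)

/-- The affine quotient `X // G = Spec A^G`. -/
noncomputable def quotient (σ : AffineAction K H A) : Scheme.{u} :=
  Spec (CommRingCat.of σ.invariants)

/-- The natural map `π : X → X // G`, dual to the inclusion of `A^G` in `A`. -/
noncomputable def quotientMap (σ : AffineAction K H A) : Spec (CommRingCat.of A) ⟶ σ.quotient :=
  Spec.map (CommRingCat.ofHom σ.invariants.val.toRingHom)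

end AffineAction

/-! ## Codimension, depth and the property `(S_i)` -/

/-- The codimension of a closed subset `Y` of a topological space `X`: the infimum, over the
irreducible closed subsets `Z` of `X` contained in `Y`, of the supremum `Order.coheight Z` of the
lengths of chains of irreducible closed subsets of `X` that start with `Z`. The codimension of
the empty set is `⊤`. -/
noncomputable def closedCodim {X : Type*} [TopologicalSpace X] (Y : Set X) : ℕ∞ :=
  ⨅ (Z : IrreducibleCloseds X) (_ : (Z : Set X) ⊆ Y), Order.coheight Z

/-- The depth of a local ring: the supremum of the lengths of the regular sequences in its
maximal ideal. -/
noncomputable def localRingDepth (R : Type*) [CommRing R] [IsLocalRing R] : ℕ∞ :=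
  ⨆ (rs : List R) (_ : (∀ r ∈ rs, r ∈ IsLocalRing.maximalIdeal R) ∧
    RingTheory.Sequence.IsRegular R rs), (rs.length : ℕ∞)

/-- The property `(S_i)` of a scheme `X`: for every irreducible closed subset `Z` of `X`, the
local ring `𝒪_{X,Z}` of `X` at the generic point of `Z` has depth at least
`min (i, codim_X Z)`. -/
def HasPropertyS (X : Scheme.{u}) (i : ℕ) : Prop :=
  ∀ Z : IrreducibleCloseds X,
    min (i : ℕ∞) (Order.coheight Z) ≤
      localRingDepth (X.presheaf.stalk Z.isIrreducible.genericPoint)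

/-!
A rational representation `V` of `G` is a module over the dual algebra of `K[G]`, with the same
subobjects, and the module generated by a vector is finite-dimensional. Reductivity of `G`
therefore makes `V` a semisimple module, in which the invariants, the vectors killed by the
augmentation ideal `I`, have `I V` as complement. For `V = A` both are `A^G`-submodules, and the
projection `A → A^G` (the Reynolds operator) exhibits `A^G` as a direct summand of `A` over `A^G`.
Hence a sequence in `A^G` which is regular on `A` is weakly regular on `A^G`.

Let `J` be the ideal of the complement of `U`. The local rings of `X` at the points over this
complement have depth at least `i`, so prime avoidance yields a sequence of length `i` in `J`,
rather than merely in `J A`, which is weakly regular on `A`. It bounds from below the depth of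
`A^G` at all points outside `U`.
-/

section Contraction

variable {K H V W : Type*} [Field K] [AddCommGroup H] [Module K H]
  [AddCommGroup V] [Module K V] [AddCommGroup W] [Module K W]

/-- The contraction `V ⊗ H → V` of the second factor against a linear form on `H`. -/
noncomputable def contract : (H →ₗ[K] K) →ₗ[K] V ⊗[K] H →ₗ[K] V :=
  LinearMap.llcomp K _ _ _ (TensorProduct.rid K V).toLinearMap ∘ₗ LinearMap.lTensorHom V

@[simp]
lemma contract_tmul (f : H →ₗ[K] K) (v : V) (h : H) : contract f (v ⊗ₜ[K] h) = f h • v := by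
  simp [contract]

lemma contract_rTensor (φ : V →ₗ[K] W) (f : H →ₗ[K] K) (t : V ⊗[K] H) :
    contract f (φ.rTensor H t) = φ (contract f t) := by
  induction t with
  | zero => simp
  | tmul v h => simp
  | add s t hs ht => simp [hs, ht]

lemma contract_lTensor {H' : Type*} [AddCommGroup H'] [Module K H'] (f : H' →ₗ[K] K)
    (δ : H →ₗ[K] H') (t : V ⊗[K] H) : contract f (δ.lTensor V t) = contract (f ∘ₗ δ) t := by
  simp [contract, LinearMap.lTensor_comp]

lemma contract_mul'_assoc (f g : H →ₗ[K] K) (t : (V ⊗[K] H) ⊗[K] H) :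
    contract (LinearMap.mul' K K ∘ₗ TensorProduct.map f g) (TensorProduct.assoc K V H H t) =
      contract f (contract g t) := by
  suffices contract (LinearMap.mul' K K ∘ₗ TensorProduct.map f g) ∘ₗ
      (TensorProduct.assoc K V H H).toLinearMap = contract f ∘ₗ contract g from
    LinearMap.congr_fun this t
  ext v h h'
  simp [mul_smul, smul_comm (f h)]

lemma eq_zero_of_contract_eq_zero {t : V ⊗[K] H} (ht : ∀ f : H →ₗ[K] K, contract f t = 0) :
    t = 0 := by
  classical
  let b := Module.Basis.ofVectorSpace K H
  have coord_eq (s : V ⊗[K] H) (j) :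
      TensorProduct.equivFinsuppOfBasisRight b s j = contract (b.coord j) s := by
    induction s with
    | zero => simp
    | tmul v h => simp
    | add s t hs ht => simp [hs, ht]
  apply (TensorProduct.equivFinsuppOfBasisRight b).injective
  ext j
  simp [coord_eq, ht]

lemma mem_range_rTensor_subtype_iff {E : Submodule K V} {t : V ⊗[K] H} :
    t ∈ LinearMap.range (E.subtype.rTensor H) ↔ ∀ f : H →ₗ[K] K, contract f t ∈ E := by
  refine ⟨?_, fun h ↦ ?_⟩
  · rintro ⟨s, rfl⟩ f
    rw [contract_rTensor]
    exact (contract f s).2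
  · refine (rTensor_exact H (LinearMap.exact_subtype_mkQ E) E.mkQ_surjective t).mp ?_
    refine eq_zero_of_contract_eq_zero fun f ↦ ?_
    rw [contract_rTensor]
    simpa using h f

lemma exists_finiteDimensional_contract_mem (t : V ⊗[K] H) :
    ∃ E : Submodule K V, FiniteDimensional K E ∧ ∀ f : H →ₗ[K] K, contract f t ∈ E := by
  induction t with
  | zero => exact ⟨⊥, inferInstance, by simp⟩
  | tmul v h =>
    exact ⟨K ∙ v, inferInstance, fun f ↦ by
      simpa using Submodule.smul_mem _ _ (Submodule.mem_span_singleton_self v)⟩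
  | add s t hs ht =>
    obtain ⟨E, _, hE⟩ := hs
    obtain ⟨F, _, hF⟩ := ht
    exact ⟨E ⊔ F, inferInstance, fun f ↦ by
      simpa using Submodule.add_mem_sup (hE f) (hF f)⟩

end Contraction

/-- The algebra of all linear forms on the coordinate ring `H = K[G]`, with the convolution product.
It contains the group algebra of `G`, a point `g` being the evaluation at `g`. -/
abbrev DualAlgebra (K H : Type*) [Field K] [CommRing H] [HopfAlgebra K H] : Type _ :=
  WithConv (H →ₗ[K] K)

namespace DualAlgebra

variable (K H : Type*) [Field K] [CommRing H] [HopfAlgebra K H]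

/-- The left ideal of the linear forms which vanish on the constant function `1`, that is, the
kernel of the trivial representation. -/
def augmentationIdeal : Ideal (DualAlgebra K H) where
  carrier := {f | f 1 = 0}
  add_mem' hf hg := by simp_all
  zero_mem' := by simp
  smul_mem' f g (hg : g 1 = 0) := by
    change (f * g) 1 = 0
    rw [LinearMap.convMul_apply, Bialgebra.comul_one, Algebra.TensorProduct.one_def,
      TensorProduct.map_tmul, LinearMap.mul'_apply, hg, mul_zero]

variable {K H}

@[simp]
lemma mem_augmentationIdeal {f : DualAlgebra K H} : f ∈ augmentationIdeal K H ↔ f 1 = 0 := .rfl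

lemma sub_algebraMap_mem_augmentationIdeal (f : DualAlgebra K H) :
    f - algebraMap K _ (f 1) ∈ augmentationIdeal K H := by
  simp [LinearMap.convAlgebraMap_apply]

end DualAlgebra

namespace RationalRep

variable {K H V : Type*} [Field K] [CommRing H] [HopfAlgebra K H] [AddCommGroup V] [Module K V]

lemma contract_coact_contract_coact (ρ : RationalRep K H V) (f g : H →ₗ[K] K) (v : V) :
    contract (LinearMap.mul' K K ∘ₗ TensorProduct.map f g ∘ₗ Coalgebra.comul) (ρ.coact v) =
      contract f (ρ.coact (contract g (ρ.coact v))) := by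
  have coassoc : TensorProduct.assoc K V H H (ρ.coact.rTensor H (ρ.coact v)) =
      Coalgebra.comul.lTensor V (ρ.coact v) := LinearMap.congr_fun ρ.coassoc v
  rw [← LinearMap.comp_assoc, ← contract_lTensor, ← coassoc, contract_mul'_assoc, contract_rTensor]

/-- The action `f • v = ∑ f(hᵢ) vᵢ` of the dual algebra, where the coaction maps `v` to
`∑ vᵢ ⊗ hᵢ`. -/
noncomputable def dualAction (ρ : RationalRep K H V) : DualAlgebra K H →ₐ[K] Module.End K V :=
  AlgHom.ofLinearMap
    (LinearMap.lcomp K V ρ.coact ∘ₗ contract ∘ₗ (WithConv.linearEquiv K (H →ₗ[K] K)).toLinearMap)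
    (LinearMap.ext (LinearMap.congr_fun ρ.counit_coact))
    fun f g ↦ LinearMap.ext (ρ.contract_coact_contract_coact f.ofConv g.ofConv)

lemma dualAction_apply (ρ : RationalRep K H V) (f : DualAlgebra K H) (v : V) :
    ρ.dualAction f v = contract f.ofConv (ρ.coact v) := rfl

/-- The space of a rational representation, viewed as a module over the dual algebra. -/
def AsModule (_ρ : RationalRep K H V) : Type _ := V

variable (ρ : RationalRep K H V)

instance : AddCommGroup ρ.AsModule := inferInstanceAs (AddCommGroup V)

instance : Module K ρ.AsModule := inferInstanceAs (Module K V)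

noncomputable instance : Module (DualAlgebra K H) ρ.AsModule :=
  Module.compHom V ρ.dualAction.toRingHom

instance : IsScalarTower K (DualAlgebra K H) ρ.AsModule where
  smul_assoc c f v := LinearMap.congr_fun (map_smul ρ.dualAction c f) v

variable {ρ}

lemma isSubrep_iff {E : Submodule K V} :
    ρ.IsSubrep E ↔ ∀ (f : DualAlgebra K H), ∀ v ∈ E, ρ.dualAction f v ∈ E := by
  simp only [IsSubrep, mem_range_rTensor_subtype_iff, dualAction_apply]
  exact ⟨fun h f v hv ↦ h v hv f.ofConv, fun h v hv f ↦ h (.toConv f) v hv⟩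

/-- The structure of a representation on a space which embeds equivariantly into one. -/
def ofInjective {W : Type*} [AddCommGroup W] [Module K W] (ρ : RationalRep K H V) (φ : W →ₗ[K] V)
    (hφ : Function.Injective φ) (coact : W →ₗ[K] W ⊗[K] H)
    (comm : φ.rTensor H ∘ₗ coact = ρ.coact ∘ₗ φ) : RationalRep K H W where
  coact := coact
  coassoc := by
    refine (LinearMap.cancel_left
      (Module.Flat.rTensor_preserves_injective_linearMap (M := H ⊗[K] H) φ hφ)).mp ?_
    have assoc_comm : φ.rTensor (H ⊗[K] H) ∘ₗ (TensorProduct.assoc K W H H).toLinearMap =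
        (TensorProduct.assoc K V H H).toLinearMap ∘ₗ (φ.rTensor H).rTensor H :=
      TensorProduct.ext_threefold fun _ _ _ ↦ rfl
    calc φ.rTensor (H ⊗[K] H) ∘ₗ (TensorProduct.assoc K W H H).toLinearMap ∘ₗ
          coact.rTensor H ∘ₗ coact
        = (TensorProduct.assoc K V H H).toLinearMap ∘ₗ
            (φ.rTensor H ∘ₗ coact).rTensor H ∘ₗ coact := by
          rw [← LinearMap.comp_assoc, assoc_comm, LinearMap.rTensor_comp]
          rfl
      _ = ((TensorProduct.assoc K V H H).toLinearMap ∘ₗ ρ.coact.rTensor H ∘ₗ ρ.coact) ∘ₗ φ := by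
          rw [comm, LinearMap.rTensor_comp, LinearMap.comp_assoc, comm]
          rfl
      _ = Coalgebra.comul.lTensor V ∘ₗ φ.rTensor H ∘ₗ coact := by
          rw [ρ.coassoc, comm]
          rfl
      _ = φ.rTensor (H ⊗[K] H) ∘ₗ Coalgebra.comul.lTensor W ∘ₗ coact := by
          rw [← LinearMap.comp_assoc, ← LinearMap.comp_assoc, LinearMap.lTensor_comp_rTensor,
            LinearMap.rTensor_comp_lTensor]
  counit_coact := by
    ext w
    apply hφ
    calc φ (contract Coalgebra.counit (coact w))
        = contract Coalgebra.counit (ρ.coact (φ w)) := by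
          rw [← contract_rTensor]
          exact congrArg _ (LinearMap.congr_fun comm w)
      _ = φ w := LinearMap.congr_fun ρ.counit_coact (φ w)

variable {E : Submodule K V}

/-- The coaction of a subrepresentation. -/
noncomputable def IsSubrep.coact (hE : ρ.IsSubrep E) : E →ₗ[K] E ⊗[K] H :=
  (ρ.coact ∘ₗ E.subtype).codRestrictOfInjective (E.subtype.rTensor H)
    (Module.Flat.rTensor_preserves_injective_linearMap _ E.injective_subtype) fun v ↦ hE v v.2

lemma IsSubrep.rTensor_subtype_comp_coact (hE : ρ.IsSubrep E) :
    E.subtype.rTensor H ∘ₗ hE.coact = ρ.coact ∘ₗ E.subtype :=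
  LinearMap.codRestrictOfInjective_comp _ _ _ _

/-- A subrepresentation as a representation. -/
noncomputable def IsSubrep.toRationalRep (hE : ρ.IsSubrep E) : RationalRep K H E :=
  ρ.ofInjective E.subtype E.injective_subtype hE.coact hE.rTensor_subtype_comp_coact

lemma IsSubrep.coe_dualAction (hE : ρ.IsSubrep E) (f : DualAlgebra K H) (v : E) :
    (hE.toRationalRep.dualAction f v : V) = ρ.dualAction f v := by
  rw [dualAction_apply, dualAction_apply, ← E.subtype_apply, ← contract_rTensor]
  exact congrArg _ (LinearMap.congr_fun hE.rTensor_subtype_comp_coact v)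

/-- A subrepresentation as a submodule over the dual algebra. -/
def IsSubrep.toSubmodule (hE : ρ.IsSubrep E) : Submodule (DualAlgebra K H) ρ.AsModule :=
  { E.toAddSubmonoid with smul_mem' := isSubrep_iff.mp hE }

/-- A submodule over the dual algebra as a subspace of the representation. -/
noncomputable def ofSubmodule (N : Submodule (DualAlgebra K H) ρ.AsModule) : Submodule K V :=
  N.restrictScalars K

lemma isSubrep_ofSubmodule (N : Submodule (DualAlgebra K H) ρ.AsModule) :
    ρ.IsSubrep (ofSubmodule N) :=
  isSubrep_iff.mpr fun f _ hv ↦ N.smul_mem f hv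

lemma isCompl_ofSubmodule_iff {N L : Submodule (DualAlgebra K H) ρ.AsModule} :
    IsCompl (ofSubmodule N) (ofSubmodule L) ↔ IsCompl N L := by
  rw [isCompl_iff, isCompl_iff, Submodule.disjoint_def, Submodule.disjoint_def,
    Submodule.codisjoint_iff_exists_add_eq, Submodule.codisjoint_iff_exists_add_eq]
  rfl

instance finiteDimensional_ofSubmodule_span_singleton (v : ρ.AsModule) :
    FiniteDimensional K (ofSubmodule (DualAlgebra K H ∙ v)) := by
  obtain ⟨E, _, hE⟩ := exists_finiteDimensional_contract_mem (ρ.coact v)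
  refine Submodule.finiteDimensional_of_le (S₂ := E) fun w hw ↦ ?_
  obtain ⟨f, rfl⟩ : ∃ f : DualAlgebra K H, f • v = w := Submodule.mem_span_singleton.mp hw
  exact hE f.ofConv

variable (ρ) in
/-- The space of invariant vectors. -/
noncomputable def invariants : Submodule K V :=
  LinearMap.eqLocus ρ.coact ((TensorProduct.mk K V H).flip 1)

@[simp]
lemma mem_invariants_iff {v : V} : v ∈ ρ.invariants ↔ ρ.coact v = v ⊗ₜ 1 := .rfl

lemma mem_invariants_iff_dualAction_eq_zero {v : V} :
    v ∈ ρ.invariants ↔ ∀ f ∈ DualAlgebra.augmentationIdeal K H, ρ.dualAction f v = 0 := by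
  rw [mem_invariants_iff]
  refine ⟨fun hv f hf ↦ ?_, fun hv ↦ sub_eq_zero.mp <| eq_zero_of_contract_eq_zero fun f ↦ ?_⟩
  · rw [dualAction_apply, hv, contract_tmul, DualAlgebra.mem_augmentationIdeal.mp hf, zero_smul]
  · have := hv _ (DualAlgebra.sub_algebraMap_mem_augmentationIdeal (.toConv f))
    rw [map_sub, AlgHom.commutes, LinearMap.sub_apply, dualAction_apply,
      Module.algebraMap_end_apply] at this
    rw [map_sub, contract_tmul]
    exact this

lemma isSubrep_invariants : ρ.IsSubrep ρ.invariants :=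
  isSubrep_iff.mpr fun f v hv ↦ by
    rw [dualAction_apply, mem_invariants_iff.mp hv, contract_tmul]
    exact ρ.invariants.smul_mem _ hv

variable (ρ) in
/-- The span of all `f • v` with `f` in the augmentation ideal, that is, the kernel of the
projection to the coinvariants. -/
noncomputable def coinvariantsKer : Submodule K V :=
  ofSubmodule (DualAlgebra.augmentationIdeal K H • ⊤ : Submodule (DualAlgebra K H) ρ.AsModule)

lemma map_mem_coinvariantsKer {φ : V →ₗ[K] V}
    (hφ : ∀ f v, φ (ρ.dualAction f v) = ρ.dualAction f (φ v)) {v : V}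
    (hv : v ∈ ρ.coinvariantsKer) : φ v ∈ ρ.coinvariantsKer := by
  let φ' : ρ.AsModule →ₗ[DualAlgebra K H] ρ.AsModule :=
    { toFun := φ, map_add' := map_add φ, map_smul' := hφ }
  suffices DualAlgebra.augmentationIdeal K H • ⊤ ≤
      (DualAlgebra.augmentationIdeal K H • ⊤ : Submodule (DualAlgebra K H) ρ.AsModule).comap φ' from
    this hv
  refine Submodule.smul_le.mpr fun f hf w _ ↦ ?_
  rw [Submodule.mem_comap, map_smul]
  exact Submodule.smul_mem_smul hf Submodule.mem_top

end RationalRep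

lemma isCompl_smul_top_of_mem_iff_smul_eq_zero {D M : Type*} [Ring D] [AddCommGroup M] [Module D M]
    [IsSemisimpleModule D M] {I : Ideal D} {N : Submodule D M}
    (hN : ∀ m, m ∈ N ↔ ∀ d ∈ I, d • m = 0) : IsCompl N (I • ⊤) := by
  constructor
  · obtain ⟨L, hL⟩ := exists_isCompl N
    refine hL.disjoint.mono_right (Submodule.smul_le.mpr fun d hd m _ ↦ ?_)
    obtain ⟨n, l, hn, hl, rfl⟩ := Submodule.codisjoint_iff_exists_add_eq.mp hL.codisjoint m
    rw [smul_add, (hN n).mp hn d hd, zero_add]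
    exact L.smul_mem d hl
  · obtain ⟨L, hL⟩ := exists_isCompl (I • ⊤ : Submodule D M)
    refine hL.symm.codisjoint.mono_left fun l hl ↦ (hN l).mpr fun d hd ↦ ?_
    exact Submodule.disjoint_def.mp hL.disjoint _
      (Submodule.smul_mem_smul hd Submodule.mem_top) (L.smul_mem d hl)

namespace IsReductiveGroup

variable {K H V : Type u} [Field K] [CommRing H] [HopfAlgebra K H] [AddCommGroup V] [Module K V]

lemma isSemisimpleModule_of_finiteDimensional (hG : IsReductiveGroup K H)
    [FiniteDimensional K V] (ρ : RationalRep K H V) :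
    IsSemisimpleModule (DualAlgebra K H) ρ.AsModule := by
  refine (isSemisimpleModule_iff _ _).mpr ⟨fun N ↦ ?_⟩
  obtain ⟨L, hL, hNL⟩ := hG V ρ _ (ρ.isSubrep_ofSubmodule N)
  exact ⟨hL.toSubmodule, RationalRep.isCompl_ofSubmodule_iff.mp hNL⟩

theorem isSemisimpleModule (hG : IsReductiveGroup K H) (ρ : RationalRep K H V) :
    IsSemisimpleModule (DualAlgebra K H) ρ.AsModule := by
  refine isSemisimpleModule_of_isSemisimpleModule_submodule'
    (p := fun v : ρ.AsModule ↦ DualAlgebra K H ∙ v) (fun v ↦ ?_) ?_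
  · have hE := ρ.isSubrep_ofSubmodule (DualAlgebra K H ∙ v)
    let e : (DualAlgebra K H ∙ v) ≃ₗ[DualAlgebra K H] hE.toRationalRep.AsModule :=
      { AddEquiv.refl _ with map_smul' f w := Subtype.ext (hE.coe_dualAction f w).symm }
    exact e.isSemisimpleModule_iff.mpr (hG.isSemisimpleModule_of_finiteDimensional _)
  · exact eq_top_iff.mpr fun v _ ↦ Submodule.mem_iSup_of_mem v (Submodule.mem_span_singleton_self v)

lemma isCompl_invariants (hG : IsReductiveGroup K H) (ρ : RationalRep K H V) :
    IsCompl ρ.invariants ρ.coinvariantsKer := by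
  have := hG.isSemisimpleModule ρ
  have isCompl : IsCompl ρ.isSubrep_invariants.toSubmodule
      (DualAlgebra.augmentationIdeal K H • ⊤ : Submodule (DualAlgebra K H) ρ.AsModule) :=
    isCompl_smul_top_of_mem_iff_smul_eq_zero fun v ↦
      RationalRep.mem_invariants_iff_dualAction_eq_zero (ρ := ρ) (v := v)
  exact RationalRep.isCompl_ofSubmodule_iff.mpr isCompl

end IsReductiveGroup

namespace AffineAction

variable {K H A : Type u} [Field K] [CommRing H] [HopfAlgebra K H] [CommRing A] [Algebra K A]

/-- The representation on the coordinate ring. -/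
def toRationalRep (σ : AffineAction K H A) : RationalRep K H A where
  coact := σ.coact.toLinearMap
  coassoc := σ.coassoc
  counit_coact := σ.counit_coact

lemma dualAction_invariant_mul (σ : AffineAction K H A) (f : DualAlgebra K H) (r : σ.invariants)
    (a : A) : σ.toRationalRep.dualAction f (r * a) = r * σ.toRationalRep.dualAction f a := by
  have mulLeft_rTensor (t : A ⊗[K] H) : (LinearMap.mulLeft K (r : A)).rTensor H t =
      (r : A) ⊗ₜ 1 * t := by
    induction t with
    | zero => simp
    | tmul v h => simp
    | add s t hs ht => simp [hs, ht, mul_add]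
  calc contract f.ofConv (σ.coact (r * a))
      = contract f.ofConv ((LinearMap.mulLeft K (r : A)).rTensor H (σ.coact a)) := by
        rw [mulLeft_rTensor, map_mul]
        exact congrArg _ (congrArg (· * σ.coact a) r.2)
    _ = r * contract f.ofConv (σ.coact a) := contract_rTensor _ _ _

/-- The **Reynolds operator**: the projection along the span of all `f • a` with `f` in the
augmentation ideal. -/
theorem exists_reynoldsOperator (σ : AffineAction K H A) (hG : IsReductiveGroup K H) :
    ∃ E : A →ₗ[σ.invariants] σ.invariants,
      E ∘ₗ Algebra.linearMap σ.invariants A = LinearMap.id := by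
  have isCompl := hG.isCompl_invariants σ.toRationalRep
  let C : Submodule σ.invariants A :=
    { σ.toRationalRep.coinvariantsKer with
      smul_mem' r _ ha := RationalRep.map_mem_coinvariantsKer (φ := LinearMap.mulLeft K (r : A))
        (fun f a ↦ (σ.dualAction_invariant_mul f r a).symm) ha }
  have range_eq (a : A) : a ∈ LinearMap.range (Algebra.linearMap σ.invariants A) ↔
      a ∈ σ.toRationalRep.invariants :=
    ⟨fun ⟨r, hr⟩ ↦ hr ▸ r.2, fun ha ↦ ⟨⟨a, ha⟩, rfl⟩⟩
  have isCompl' : IsCompl (LinearMap.range (Algebra.linearMap σ.invariants A)) C := by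
    rw [isCompl_iff, Submodule.disjoint_def, Submodule.codisjoint_iff_exists_add_eq] at isCompl ⊢
    simp only [range_eq]
    exact isCompl
  exact ⟨LinearMap.linearProjOfIsCompl C _ Subtype.val_injective isCompl', LinearMap.ext fun r ↦
    LinearMap.linearProjOfIsCompl_apply_left C (Algebra.linearMap σ.invariants A)
      Subtype.val_injective isCompl' r⟩

end AffineAction

section RegularSequences

open CategoryTheory Abelian Module.associatedPrimes RingTheory.Sequence

lemma isWeaklyRegular_of_retract {R M N : Type*} [CommRing R] [AddCommGroup M] [Module R M]
    [AddCommGroup N] [Module R N] {f : N →ₗ[R] M} {g : M →ₗ[R] N}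
    (hgf : g ∘ₗ f = LinearMap.id) {rs : List R} (reg : IsWeaklyRegular M rs) :
    IsWeaklyRegular N rs := by
  induction rs generalizing M N with
  | nil => exact .nil R N
  | cons r rs ih =>
    obtain ⟨hr, hrs⟩ := (isWeaklyRegular_cons_iff M r rs).mp reg
    have injective_f : Function.Injective f := Function.LeftInverse.injective fun x ↦
      LinearMap.congr_fun hgf x
    have map_hgf : QuotSMulTop.map r g ∘ₗ QuotSMulTop.map r f = LinearMap.id := by
      rw [← QuotSMulTop.map_comp, hgf, QuotSMulTop.map_id]
    exact .cons (hr.of_injective f injective_f) (ih map_hgf hrs)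

/-- The grade of the ideal `I` on the module `M` is at least `n`: there is an `M`-regular sequence
of length `n` in `I`. -/
def HasRegularSequence {R : Type*} [CommRing R] (I : Ideal R) (M : Type*) [AddCommGroup M]
    [Module R M] (n : ℕ) : Prop :=
  ∃ rs : List R, rs.length = n ∧ (∀ r ∈ rs, r ∈ I) ∧ IsRegular M rs

lemma HasRegularSequence.congr {R M N : Type*} [CommRing R] [AddCommGroup M] [Module R M]
    [AddCommGroup N] [Module R N] {I : Ideal R} {n : ℕ} (h : HasRegularSequence I M n)
    (e : M ≃ₗ[R] N) : HasRegularSequence I N n :=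
  let ⟨rs, hlen, hmem, reg⟩ := h
  ⟨rs, hlen, hmem, (e.isRegular_congr rs).mp reg⟩

lemma smul_top_quotSMulTop_lt_top {R M : Type*} [CommRing R] [AddCommGroup M] [Module R M]
    {I : Ideal R} {x : R} (hx : x ∈ I) (h : I • (⊤ : Submodule R M) < ⊤) :
    I • (⊤ : Submodule R (QuotSMulTop x M)) < ⊤ := by
  refine lt_top_iff_ne_top.mpr fun eq ↦ h.ne ?_
  have := congrArg (Submodule.comap (Submodule.mkQ _)) eq
  simpa [Submodule.comap_smul_top_of_surjective I _ (Submodule.mkQ_surjective _),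
    Submodule.smul_mono_left ((Ideal.span_singleton_le_iff_mem I).mpr hx),
    ← Submodule.ideal_span_singleton_smul] using this

/-- By Rees' theorem the grade is the least degree in which `Ext (R ⧸ I) M` does not vanish, and
multiplication by `x` gives a long exact sequence of these groups. -/
lemma HasRegularSequence.quotSMulTop {R M : Type u} [CommRing R] [IsNoetherianRing R]
    [AddCommGroup M] [Module R M] [Module.Finite R M] {I : Ideal R} {n : ℕ}
    (h : HasRegularSequence I M (n + 1)) (hI : I • (⊤ : Submodule R M) < ⊤) {x : R} (hxI : x ∈ I)
    (hx : IsSMulRegular M x) : HasRegularSequence I (QuotSMulTop x M) n := by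
  have subsingleton_ext : ∀ j < n + 1, Subsingleton (Ext (ModuleCat.of R (Shrink.{u} (R ⧸ I)))
      (ModuleCat.of R M) j) :=
    ((ModuleCat.exists_isRegular_tfae I (n + 1) (ModuleCat.of R M) hI).out 3 1).mp h
  refine ((ModuleCat.exists_isRegular_tfae I n (ModuleCat.of R (QuotSMulTop x M))
    (smul_top_quotSMulTop_lt_top hxI hI)).out 1 3).mp fun j hj ↦ ?_
  have zero₁ := AddCommGrpCat.isZero_of_iff_subsingleton.mpr (subsingleton_ext j (by omega))
  have zero₂ := AddCommGrpCat.isZero_of_iff_subsingleton.mpr (subsingleton_ext (j + 1) (by omega))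
  have hx' : IsSMulRegular (ModuleCat.of R M) x := hx
  exact AddCommGrpCat.subsingleton_of_isZero <| ShortComplex.Exact.isZero_of_both_zeros
    (Ext.covariant_sequence_exact₃' _ hx'.smulShortComplex_shortExact j (j + 1) rfl)
    (zero₁.eq_zero_of_src _) (zero₂.eq_zero_of_tgt _)

lemma not_hasRegularSequence_succ_of_mem_associatedPrimes {R M : Type*} [CommRing R]
    [IsNoetherianRing R] [AddCommGroup M] [Module R M] {I : Ideal R}
    (hI : I ∈ associatedPrimes R M) (n : ℕ) : ¬ HasRegularSequence I M (n + 1) := by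
  rintro ⟨rs, hlen, hmem, reg⟩
  obtain ⟨r, rs, rfl⟩ := List.exists_cons_of_length_eq_add_one hlen
  have hr : r ∈ ⋃ p ∈ associatedPrimes R M, (p : Set R) :=
    Set.mem_biUnion hI (hmem r List.mem_cons_self)
  rw [biUnion_associatedPrimes_eq_zero_divisors] at hr
  obtain ⟨m, hm, hrm⟩ := hr
  exact hm (((isRegular_cons_iff _ _ _).mp reg).1.right_eq_zero_of_smul hrm)

lemma maximalIdeal_mem_associatedPrimes_localization {S M : Type*} [CommRing S] [AddCommGroup M]
    [Module S M] {q : Ideal S} [q.IsPrime] (hq : q ∈ associatedPrimes S M) :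
    IsLocalRing.maximalIdeal (Localization.AtPrime q) ∈
      associatedPrimes (Localization.AtPrime q) (Localization.AtPrime q ⊗[S] M) := by
  have : IsLocalizedModule q.primeCompl (TensorProduct.mk S (Localization.AtPrime q) M 1) :=
    (isLocalizedModule_iff_isBaseChange q.primeCompl (Localization.AtPrime q) _).mpr
      (TensorProduct.isBaseChange S M (Localization.AtPrime q))
  apply mem_associatedPrimes_of_comap_mem_associatedPrimes_of_isLocalizedModule q.primeCompl
    (TensorProduct.mk S (Localization.AtPrime q) M 1)
  simpa [Localization.AtPrime.under_maximalIdeal] using hq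

lemma HasRegularSequence.localization_quotSMulTop {S M : Type u} [CommRing S] [IsNoetherianRing S]
    [AddCommGroup M] [Module S M] [Module.Finite S M] {q : Ideal S} [q.IsPrime] {n : ℕ}
    (h : HasRegularSequence (IsLocalRing.maximalIdeal (Localization.AtPrime q))
      (Localization.AtPrime q ⊗[S] M) (n + 1)) {x : S} (hxq : x ∈ q) (hx : IsSMulRegular M x) :
    HasRegularSequence (IsLocalRing.maximalIdeal (Localization.AtPrime q))
      (Localization.AtPrime q ⊗[S] QuotSMulTop x M) n := by
  have : Nontrivial (Localization.AtPrime q ⊗[S] M) :=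
    let ⟨_, _, _, reg⟩ := h
    reg.nontrivial
  have smul_top_lt_top : IsLocalRing.maximalIdeal (Localization.AtPrime q) •
      (⊤ : Submodule _ (Localization.AtPrime q ⊗[S] M)) < ⊤ :=
    lt_top_iff_ne_top.mpr (Submodule.top_ne_ideal_smul_of_le_jacobson_annihilator
      (IsLocalRing.maximalIdeal_le_jacobson _)).symm
  exact (h.quotSMulTop smul_top_lt_top
    ((IsLocalization.AtPrime.to_map_mem_maximal_iff _ q x).mpr hxq)
    (hx.of_flat_of_isBaseChange (TensorProduct.isBaseChange S M (Localization.AtPrime q)))).congr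
    (QuotSMulTop.algebraMapTensorEquivTensorQuotSMulTop x M (Localization.AtPrime q))

/-- Prime avoidance is applied to the contractions to `R` of the associated primes of `M`. -/
lemma exists_mem_isSMulRegular_algebraMap {R S M : Type*} [CommRing R] [CommRing S] [Algebra R S]
    [IsNoetherianRing S] [AddCommGroup M] [Module S M] [Module.Finite S M] {I : Ideal R}
    (hI : ∀ q ∈ associatedPrimes S M, ¬ I.map (algebraMap R S) ≤ q) :
    ∃ x ∈ I, IsSMulRegular M (algebraMap R S x) := by
  by_contra! not_regular
  have subset_union : (I : Set R) ⊆ ⋃ q ∈ associatedPrimes S M, q.comap (algebraMap R S) := by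
    intro x hx
    obtain ⟨m, hxm, hm⟩ : ∃ m : M, algebraMap R S x • m = 0 ∧ m ≠ 0 := by
      simpa [isSMulRegular_iff_right_eq_zero_of_smul] using not_regular x hx
    have : algebraMap R S x ∈ ⋃ q ∈ associatedPrimes S M, (q : Set S) := by
      rw [biUnion_associatedPrimes_eq_zero_divisors]
      exact ⟨m, hm, hxm⟩
    simpa using this
  rw [Ideal.subset_union_prime_finite (associatedPrimes.finite S M) ⊥ ⊥
    fun q hq _ _ ↦ have := hq.isPrime; inferInstance] at subset_union
  obtain ⟨q, hq, hIq⟩ := subset_union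
  exact hI q hq (Ideal.map_le_iff_le_comap.mpr hIq)

theorem exists_isWeaklyRegular_of_forall_localization {R : Type*} {S M : Type u} [CommRing R]
    [CommRing S] [Algebra R S] [IsNoetherianRing S] [AddCommGroup M] [Module S M]
    [Module.Finite S M] (I : Ideal R) (n : ℕ)
    (h : ∀ (q : Ideal S) [q.IsPrime], I.map (algebraMap R S) ≤ q →
      HasRegularSequence (IsLocalRing.maximalIdeal (Localization.AtPrime q))
        (Localization.AtPrime q ⊗[S] M) n) :
    ∃ rs : List R, rs.length = n ∧ (∀ r ∈ rs, r ∈ I) ∧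
      IsWeaklyRegular M (rs.map (algebraMap R S)) := by
  induction n generalizing M with
  | zero => exact ⟨[], by simp⟩
  | succ n ih =>
    obtain ⟨x, hxI, hx⟩ := exists_mem_isSMulRegular_algebraMap (I := I) (S := S) (M := M)
      fun q hq hIq ↦ have := hq.isPrime
        not_hasRegularSequence_succ_of_mem_associatedPrimes
          (maximalIdeal_mem_associatedPrimes_localization hq) n (h q hIq)
    obtain ⟨rs, hlen, hmem, reg⟩ := ih fun q _ hIq ↦
      (h q hIq).localization_quotSMulTop (hIq (Ideal.mem_map_of_mem _ hxI)) hx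
    exact ⟨x :: rs, by simp [hlen], by simpa [hxI] using hmem, by simpa using ⟨hx, reg⟩⟩

end RegularSequences

section Depth

open RingTheory.Sequence

lemma natCast_le_localRingDepth_iff {R : Type*} [CommRing R] [IsLocalRing R] {n : ℕ} :
    (n : ℕ∞) ≤ localRingDepth R ↔ HasRegularSequence (IsLocalRing.maximalIdeal R) R n := by
  refine ⟨fun h ↦ ?_, fun ⟨rs, hlen, hmem, reg⟩ ↦ hlen ▸ le_iSup₂_of_le rs ⟨hmem, reg⟩ le_rfl⟩
  cases n with
  | zero => exact ⟨[], by simp, by simp, IsRegular.nil R R⟩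
  | succ n =>
    obtain ⟨rs, ⟨hmem, reg⟩, hlen⟩ : ∃ rs : List R,
        ((∀ r ∈ rs, r ∈ IsLocalRing.maximalIdeal R) ∧ IsRegular R rs) ∧ n < rs.length := by
      have lt_depth := (Nat.cast_lt.mpr n.lt_succ_self).trans_le h
      simpa only [localRingDepth, lt_iSup_iff, Nat.cast_lt, exists_prop] using lt_depth
    have hmem_take (r) (hr : r ∈ rs.take (n + 1)) := hmem r (List.mem_of_mem_take hr)
    have weaklyRegular := reg.toIsWeaklyRegular
    rw [← List.take_append_drop (n + 1) rs, isWeaklyRegular_append_iff] at weaklyRegular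
    exact ⟨rs.take (n + 1), by simpa using hlen, hmem_take,
      .of_isWeaklyRegular_of_mem_maximalIdeal R hmem_take weaklyRegular.1⟩

lemma localRingDepth_le_of_ringEquiv {R S : Type*} [CommRing R] [IsLocalRing R] [CommRing S]
    [IsLocalRing S] (e : R ≃+* S) : localRingDepth R ≤ localRingDepth S := by
  refine iSup₂_le fun rs ⟨hmem, reg⟩ ↦ le_iSup₂_of_le (rs.map e) ⟨?_, ?_⟩ (by simp)
  · simpa [MulEquiv.isUnit_map] using hmem
  · exact (e.toAddEquiv.isRegular_congr <| List.forall₂_map_right_iff.mpr <|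
      List.forall₂_same.mpr fun r _ x ↦ map_mul e r x).mp reg

lemma localRingDepth_eq_of_ringEquiv {R S : Type*} [CommRing R] [IsLocalRing R] [CommRing S]
    [IsLocalRing S] (e : R ≃+* S) : localRingDepth R = localRingDepth S :=
  le_antisymm (localRingDepth_le_of_ringEquiv e) (localRingDepth_le_of_ringEquiv e.symm)

lemma localRingDepth_stalk_spec {R : Type u} [CommRing R] (x : Spec (CommRingCat.of R))
    {p : Ideal R} [p.IsPrime] (hx : PrimeSpectrum.asIdeal x = p) :
    localRingDepth ((Spec (CommRingCat.of R)).presheaf.stalk x) =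
      localRingDepth (Localization.AtPrime p) := by
  subst hx
  exact localRingDepth_eq_of_ringEquiv
    (Spec.stalkIso (CommRingCat.of R) x).commRingCatIsoToRingEquiv

lemma length_le_localRingDepth_localization {R : Type u} [CommRing R]
    {rs : List R} (reg : IsWeaklyRegular R rs) {p : Ideal R} [p.IsPrime]
    (hmem : ∀ r ∈ rs, r ∈ p) : (rs.length : ℕ∞) ≤ localRingDepth (Localization.AtPrime p) := by
  refine natCast_le_localRingDepth_iff.mpr ⟨rs.map (algebraMap R _), List.length_map _,
    List.forall_mem_map.mpr fun r hr ↦ ?_, reg.isRegular_of_isLocalization_of_mem _ p hmem⟩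
  exact (IsLocalization.AtPrime.to_map_mem_maximal_iff _ p r).mpr (hmem r hr)

end Depth

lemma closedCodim_le_coheight {X : Scheme.{u}} {Y : Set X} (hY : IsClosed Y) {x : X} (hx : x ∈ Y) :
    closedCodim Y ≤ Order.coheight x := by
  let Z : IrreducibleCloseds X := irreducibleSetEquivPoints.symm x
  have hZ : (Z : Set X) ⊆ Y := hY.closure_subset_iff.mpr (Set.singleton_subset_iff.mpr hx)
  exact (iInf₂_le Z hZ).trans_eq (Order.coheight_orderIso irreducibleSetEquivPoints.symm x)

lemma hasPropertyS_iff {X : Scheme.{u}} {i : ℕ} : HasPropertyS X i ↔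
    ∀ x : X, min (i : ℕ∞) (Order.coheight x) ≤ localRingDepth (X.presheaf.stalk x) := by
  refine irreducibleSetEquivPoints.toEquiv.forall_congr fun {Z} ↦ ?_
  rw [← Order.coheight_orderIso irreducibleSetEquivPoints Z]
  rfl

namespace HasPropertyS

variable {X : Scheme.{u}} {i : ℕ}

lemma min_le_localRingDepth_of_mem {U : X.Opens} (hU : HasPropertyS (U : Scheme.{u}) i) {x : X}
    (hx : x ∈ U) : min (i : ℕ∞) (Order.coheight x) ≤ localRingDepth (X.presheaf.stalk x) := by
  let y : (U : Scheme.{u}) := ⟨x, hx⟩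
  have coheight_eq : Order.coheight x = Order.coheight y :=
    coheight_eq_of_isOpenImmersion (x := y) U.ι
  have depth_eq : localRingDepth ((U : Scheme.{u}).presheaf.stalk y) =
      localRingDepth (X.presheaf.stalk x) :=
    localRingDepth_eq_of_ringEquiv (U.stalkIso y).commRingCatIsoToRingEquiv
  rw [coheight_eq, ← depth_eq]
  exact hasPropertyS_iff.mp hU y

lemma le_localRingDepth_of_le_closedCodim (hX : HasPropertyS X i) {Y : Set X} (hY : IsClosed Y)
    (hcodim : (i : ℕ∞) ≤ closedCodim Y) {x : X} (hx : x ∈ Y) :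
    (i : ℕ∞) ≤ localRingDepth (X.presheaf.stalk x) :=
  (le_min le_rfl (hcodim.trans (closedCodim_le_coheight hY hx))).trans (hasPropertyS_iff.mp hX x)

end HasPropertyS

lemma exists_isWeaklyRegular_of_le_closedCodim {R : Type*} {A : Type u} [CommRing R] [CommRing A]
    [Algebra R A] [IsNoetherianRing A] {i : ℕ} (hX : HasPropertyS (Spec (CommRingCat.of A)) i)
    (I : Ideal R) (hcodim : (i : ℕ∞) ≤ closedCodim (X := Spec (CommRingCat.of A))
      (PrimeSpectrum.zeroLocus (I.map (algebraMap R A)))) :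
    ∃ rs : List R, rs.length = i ∧ (∀ r ∈ rs, r ∈ I) ∧
      RingTheory.Sequence.IsWeaklyRegular A rs := by
  have localDepth (q : Ideal A) [hq : q.IsPrime] (hIq : I.map (algebraMap R A) ≤ q) :
      HasRegularSequence (IsLocalRing.maximalIdeal (Localization.AtPrime q))
        (Localization.AtPrime q ⊗[A] A) i := by
    let x : Spec (CommRingCat.of A) := (⟨q, hq⟩ : PrimeSpectrum A)
    have le_depth : (i : ℕ∞) ≤ localRingDepth (Localization.AtPrime q) :=
      localRingDepth_stalk_spec x (p := q) rfl ▸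
        hX.le_localRingDepth_of_le_closedCodim (PrimeSpectrum.isClosed_zeroLocus _) hcodim hIq
    exact (natCast_le_localRingDepth_iff.mp le_depth).congr
      (TensorProduct.AlgebraTensorModule.rid A (Localization.AtPrime q) _).symm
  obtain ⟨rs, hlen, hmem, reg⟩ := exists_isWeaklyRegular_of_forall_localization I i localDepth
  exact ⟨rs, hlen, hmem, (RingTheory.Sequence.isWeaklyRegular_map_algebraMap_iff A A rs).mp reg⟩

theorem HasPropertyS.of_retraction {R A : Type u} [CommRing R] [CommRing A] [Algebra R A]
    [IsNoetherianRing A] {ρ : A →ₗ[R] R} (hρ : ρ ∘ₗ Algebra.linearMap R A = LinearMap.id)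
    {i : ℕ} {U : (Spec (CommRingCat.of R)).Opens}
    (hX : HasPropertyS (Spec (CommRingCat.of A)) i) (hU : HasPropertyS (U : Scheme.{u}) i)
    (hcodim : (i : ℕ∞) ≤ closedCodim
      (Spec.map (CommRingCat.ofHom (algebraMap R A)) ⁻¹' (U : Set (Spec (CommRingCat.of R)))ᶜ)) :
    HasPropertyS (Spec (CommRingCat.of R)) i := by
  refine hasPropertyS_iff.mpr fun x ↦ ?_
  by_cases hx : x ∈ U
  · exact hU.min_le_localRingDepth_of_mem hx
  obtain ⟨I, hI⟩ := (PrimeSpectrum.isClosed_iff_zeroLocus_ideal _).mp U.isOpen.isClosed_compl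
  have preimage_eq : Spec.map (CommRingCat.ofHom (algebraMap R A)) ⁻¹'
      (U : Set (Spec (CommRingCat.of R)))ᶜ = PrimeSpectrum.zeroLocus (I.map (algebraMap R A)) := by
    rw [hI, Ideal.map, PrimeSpectrum.zeroLocus_span]
    exact PrimeSpectrum.preimage_comap_zeroLocus (algebraMap R A) I
  rw [preimage_eq] at hcodim
  obtain ⟨rs, rfl, hmem, reg⟩ := exists_isWeaklyRegular_of_le_closedCodim hX I hcodim
  let p : PrimeSpectrum R := x
  have hp : p ∈ PrimeSpectrum.zeroLocus I := hI ▸ hx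
  calc min (rs.length : ℕ∞) (Order.coheight x)
      ≤ rs.length := min_le_left _ _
    _ ≤ localRingDepth (Localization.AtPrime p.asIdeal) :=
      length_le_localRingDepth_localization (isWeaklyRegular_of_retract hρ reg)
        fun r hr ↦ hp (hmem r hr)
    _ = localRingDepth ((Spec (CommRingCat.of R)).presheaf.stalk x) :=
      (localRingDepth_stalk_spec x (p := p.asIdeal) rfl).symm

theorem theorem7p1_general {K H A : Type u} [Field K] [CommRing H] [HopfAlgebra K H]
    (hG : IsReductiveGroup K H) [CommRing A] [Algebra K A] [IsNoetherianRing A]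
    (σ : AffineAction K H A) (i : ℕ) (U : σ.quotient.Opens)
    (hX : HasPropertyS (Spec (CommRingCat.of A)) i)
    (hU : HasPropertyS (U : Scheme.{u}) i)
    (hcodim : (i : ℕ∞) ≤ closedCodim (σ.quotientMap ⁻¹' (U : Set σ.quotient)ᶜ)) :
    HasPropertyS σ.quotient i :=
  let ⟨_, retraction⟩ := σ.exists_reynoldsOperator hG
  HasPropertyS.of_retraction retraction hX hU hcodim

theorem theorem7p1 {K H A : Type u} [Field K] [IsAlgClosed K] [CharZero K]
    [CommRing H] [HopfAlgebra K H] [Algebra.FiniteType K H] (hG : IsReductiveGroup K H)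
    [CommRing A] [Algebra K A] [Algebra.FiniteType K A]
    [IrreducibleSpace (Spec (CommRingCat.of A))]
    (σ : AffineAction K H A) (i : ℕ) (U : σ.quotient.Opens)
    (hX : HasPropertyS (Spec (CommRingCat.of A)) i)
    (hU : HasPropertyS (U : Scheme.{u}) i)
    (hcodim : (i : ℕ∞) ≤ closedCodim (σ.quotientMap ⁻¹' (U : Set σ.quotient)ᶜ)) :
    HasPropertyS σ.quotient i :=
  have := Algebra.FiniteType.isNoetherianRing K A
  theorem7p1_general hG σ i U hX hU hcodim
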